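/- A rank-one quantum game is given by unit vectors $|\psi\rangle,|\gamma\rangle\in\mathcal H_A\otimes\mathcal H_B\otimes\mathcal H_C$ (all spaces finite-dimensional): a referee prepares $|\psi\rangle$, sends registers $A$ and $B$ to Alice and Bob, and after they return them measures with the projection $P=|\gamma\rangle\langle\gamma|$; the outcome $P$ means that they win. Put $M_{AB}=\mathrm{tr}_C|\psi\rangle\langle\gamma|$. The entangled value $\omega^*(G)$ is the supremum of the winning probability $$\mathrm{tr}\big((P\otimes 1_{A'B'})\,(T_{AA'}\otimes S_{BB'}\otimes \mathrm{id}_C)(|\psi\rangle|\xi\rangle\langle\psi|\langle\xi|)\big)$$ over all finite-dimensional $\mathcal H_{A'},\mathcal H_{B'}$, unit vectors $|\xi\rangle\in\mathcal H_{A'}\otimes\mathcal H_{B'}$ and quantum operations (completely positive trace-preserving maps) $T_{AA'}$ on $\mathcal H_A\otimes\mathcal H_{A'}$ and $S_{BB'}$ on $\mathcal H_B\otimes\mathcal H_{B'}$. The maximal value is $V(G)=\|M_{AB}\|_1^2$, where $\|\cdot\|_1$ is the trace norm. If $\mathcal H_A=\mathcal H_B$, then $G$ is a Schur game with multiplier matrix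 $\phi$ if the map $\widehat M_{AB}(X)_{sv}=\sum_{r,u}(M_{AB})_{(r,s),(u,v)}X_{ru}$ satisfies $\widehat M_{AB}(X)_{ij}=\phi_{ij}X_{ij}$ for all matrices $X$. For $n\ge 0$ let $A_n$ be the rank-one quantum game with $$|\psi_n\rangle=2^{-n}\big((|00\rangle+|11\rangle)_{AB}|0\rangle_C+(|00\rangle-|11\rangle)_{AB}|1\rangle_C\big)^{\otimes n},\qquad |\gamma_n\rangle=2^{-n/2}\big(|00\rangle_{AB}|0\rangle_C+|11\rangle_{AB}|1\rangle_C\big)^{\otimes n}.$$ **Theorem.** For every $n$, the game $A_n$ is a Schur game with multiplier matrix $\phi_n=2^{-3n/2}A^{\otimes n}$, where $A=\begin{pmatrix}1&1\\1&-1\end{pmatrix}$. Its maximal value is $V(A_n)=1$; moreover, the supremum of the winning probabilities of a single player with access to both $A$ and $B$ (and to an auxiliary register in an arbitrary pure state), applying an arbitrary quantum operation, is also $1$. Its entangled value, the (finite) supremum above, satisfies $\omega^*(A_n)\le 2^{-n}$. -/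

import Mathlib

open scoped Matrix Kronecker ComplexOrder

/-! ## Operators on tensor products

Finite-dimensional Hilbert spaces are the spaces `ℂ^ι` for a finite index type `ι`; the tensor
product of `ℂ^ι` and `ℂ^κ` is `ℂ^(ι × κ)`, and operators on `ℂ^ι` are matrices. -/

/-- The tensor product `T ⊗ S` of two linear maps between matrix spaces, acting on operators on a
tensor product: `S` acts on the second factor, then `T` on the first. -/
def tensorMap {ι κ : Type*} (T : Matrix ι ι ℂ →ₗ[ℂ] Matrix ι ι ℂ)
    (S : Matrix κ κ ℂ →ₗ[ℂ] Matrix κ κ ℂ) :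
    Matrix (ι × κ) (ι × κ) ℂ →ₗ[ℂ] Matrix (ι × κ) (ι × κ) ℂ where
  toFun X := Matrix.of fun p q =>
    T (Matrix.of fun i i' => S (X.submatrix (Prod.mk i) (Prod.mk i')) p.2 q.2) p.1 q.1
  map_add' X Y := by
    ext p q
    simp only [Matrix.submatrix_add, Pi.add_apply, map_add, Matrix.add_apply, Matrix.of_apply]
    rw [← Matrix.add_apply, ← map_add]
    rfl
  map_smul' r X := by
    ext p q
    simp only [Matrix.submatrix_smul, Pi.smul_apply, map_smul, Matrix.smul_apply, Matrix.of_apply,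
      RingHom.id_apply]
    rw [← Matrix.smul_apply, ← map_smul]
    rfl

theorem tensorMap_kronecker {ι κ : Type*} (T : Matrix ι ι ℂ →ₗ[ℂ] Matrix ι ι ℂ)
    (S : Matrix κ κ ℂ →ₗ[ℂ] Matrix κ κ ℂ) (X : Matrix ι ι ℂ) (Y : Matrix κ κ ℂ) :
    tensorMap T S (X ⊗ₖ Y) = T X ⊗ₖ S Y := by
  ext p q
  have h1 : ∀ i i', (X ⊗ₖ Y).submatrix (Prod.mk i) (Prod.mk i') = X i i' • Y :=
    fun _ _ => rfl
  have h2 : (Matrix.of fun i i' => X i i' * S Y p.2 q.2) = S Y p.2 q.2 • X := by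
    ext i i'
    simp [mul_comm]
  simp [tensorMap, h1, h2, mul_comm]

/-- `T` is completely positive: `id ⊗ T` preserves positive semidefinite operators on
`ℂ^k ⊗ ℂ^ι` for every `k`. -/
def IsCompletelyPositive {ι : Type*} (T : Matrix ι ι ℂ →ₗ[ℂ] Matrix ι ι ℂ) : Prop :=
  ∀ (k : ℕ) (X : Matrix (Fin k × ι) (Fin k × ι) ℂ),
    X.PosSemidef → (tensorMap LinearMap.id T X).PosSemidef

/-- Quantum operations (channels) on `ℂ^ι`: completely positive trace-preserving linear maps. -/
structure IsQuantumOperation {ι : Type*} [Fintype ι]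
    (T : Matrix ι ι ℂ →ₗ[ℂ] Matrix ι ι ℂ) : Prop where
  completelyPositive : IsCompletelyPositive T
  trace_preserving : ∀ X, (T X).trace = X.trace

/-- The trace norm: the sum of the singular values. -/
noncomputable def traceNorm {ι : Type*} [Fintype ι] [DecidableEq ι] (M : Matrix ι ι ℂ) : ℝ :=
  (Matrix.toEuclideanLin M).singularValues.sum fun _ s => s

/-- The tensor power `A^{⊗ n}`, with `(ℂ^ι)^{⊗ n} = ℂ^(Fin n → ι)`. -/
def Matrix.tensorPow {ι : Type*} (A : Matrix ι ι ℂ) (n : ℕ) :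
    Matrix (Fin n → ι) (Fin n → ι) ℂ :=
  Matrix.of fun x y => ∏ k, A (x k) (y k)

/-! ## Rank-one quantum games -/

/-- A rank-one quantum game with question registers `A`, `B` and private referee register `C`:
the referee prepares the state `ψ` and finally measures with the projection `|γ⟩⟨γ|`. -/
structure RankOneGame (a b c : Type*) [Fintype a] [Fintype b] [Fintype c] where
  ψ : EuclideanSpace ℂ (a × b × c)
  γ : EuclideanSpace ℂ (a × b × c)
  norm_ψ : ‖ψ‖ = 1
  norm_γ : ‖γ‖ = 1

namespace RankOneGame

variable {a b c : Type*} [Fintype a] [Fintype b] [Fintype c]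
  [DecidableEq a] [DecidableEq b] [DecidableEq c]

/-- The operator `M_AB = tr_C |ψ⟩⟨γ|` on `ℂ^a ⊗ ℂ^b`. -/
def reduced (G : RankOneGame a b c) : Matrix (a × b) (a × b) ℂ :=
  Matrix.of fun p q => ∑ k, G.ψ (p.1, p.2, k) * star (G.γ (q.1, q.2, k))

/-- The map from operators on `ℂ^a` to operators on `ℂ^b` associated with `M_AB` through
`(∑ Aᵢ ⊗ Bᵢ)(X) = ∑ tr(Aᵢ Xᵀ) Bᵢ`. -/
def reducedMap (G : RankOneGame a b c) (X : Matrix a a ℂ) : Matrix b b ℂ :=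
  Matrix.of fun s v => ∑ r, ∑ u, G.reduced (r, s) (u, v) * X r u

/-- `G` is a Schur game with multiplier matrix `φ`: the map associated with `M_AB` is entrywise
multiplication by `φ`. -/
def IsSchurGameWith (G : RankOneGame a a c) (φ : Matrix a a ℂ) : Prop :=
  ∀ X : Matrix a a ℂ, G.reducedMap X = φ ⊙ X

/-- The maximal value `V(G) = ‖M_AB‖₁²`. -/
noncomputable def maximalValue (G : RankOneGame a b c) : ℝ :=
  traceNorm G.reduced ^ 2

/-- The pure state `|ψ⟩|ξ⟩`, where the players share the state `ξ` of `A'B'`; the registers are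
grouped as `(AA')(BB')C`. -/
def sharedInput (G : RankOneGame a b c) {a' b' : Type*} (ξ : EuclideanSpace ℂ (a' × b')) :
    (a × a') × (b × b') × c → ℂ :=
  fun p => G.ψ (p.1.1, p.2.1.1, p.2.2) * ξ (p.1.2, p.2.1.2)

/-- The winning projection `|γ⟩⟨γ|_{ABC} ⊗ 1_{A'B'}`, registers grouped as `(AA')(BB')C`. -/
def sharedProjection (G : RankOneGame a b c) (a' b' : Type*) [DecidableEq a'] [DecidableEq b'] :
    Matrix ((a × a') × (b × b') × c) ((a × a') × (b × b') × c) ℂ :=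
  Matrix.of fun p q =>
    if p.1.2 = q.1.2 ∧ p.2.1.2 = q.2.1.2 then
      G.γ (p.1.1, p.2.1.1, p.2.2) * star (G.γ (q.1.1, q.2.1.1, q.2.2))
    else 0

/-- The winning probability when Alice and Bob share `ξ` and apply the quantum operations `T` on
`AA'` and `S` on `BB'`. -/
def entangledWinProb (G : RankOneGame a b c) {a' b' : Type*} [Fintype a'] [Fintype b']
    [DecidableEq a'] [DecidableEq b'] (ξ : EuclideanSpace ℂ (a' × b'))
    (T : Matrix (a × a') (a × a') ℂ →ₗ[ℂ] Matrix (a × a') (a × a') ℂ)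
    (S : Matrix (b × b') (b × b') ℂ →ₗ[ℂ] Matrix (b × b') (b × b') ℂ) : ℝ :=
  (G.sharedProjection a' b' *
    tensorMap T (tensorMap S LinearMap.id)
      (Matrix.vecMulVec (G.sharedInput ξ) (star (G.sharedInput ξ)))).trace.re

/-- The winning probabilities of all strategies with finite-dimensional shared entanglement. -/
def entangledWinProbs (G : RankOneGame a b c) : Set ℝ :=
  {p | ∃ (m n : ℕ) (ξ : EuclideanSpace ℂ (Fin m × Fin n))
    (T : Matrix (a × Fin m) (a × Fin m) ℂ →ₗ[ℂ] Matrix (a × Fin m) (a × Fin m) ℂ)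
    (S : Matrix (b × Fin n) (b × Fin n) ℂ →ₗ[ℂ] Matrix (b × Fin n) (b × Fin n) ℂ),
    ‖ξ‖ = 1 ∧ IsQuantumOperation T ∧ IsQuantumOperation S ∧ p = G.entangledWinProb ξ T S}

/-- The entangled value `ω*(G)`. -/
noncomputable def entangledValue (G : RankOneGame a b c) : ℝ :=
  sSup G.entangledWinProbs

/-- The pure state `|ψ⟩|η⟩`, where a single player holding `A` and `B` also holds the state `η` of
an auxiliary register `E`; the registers are grouped as `(ABE)C`. -/
def singleInput (G : RankOneGame a b c) {e : Type*} (η : EuclideanSpace ℂ e) :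
    (a × b × e) × c → ℂ :=
  fun p => G.ψ (p.1.1, p.1.2.1, p.2) * η p.1.2.2

/-- The winning projection `|γ⟩⟨γ|_{ABC} ⊗ 1_E`, registers grouped as `(ABE)C`. -/
def singleProjection (G : RankOneGame a b c) (e : Type*) [DecidableEq e] :
    Matrix ((a × b × e) × c) ((a × b × e) × c) ℂ :=
  Matrix.of fun p q =>
    if p.1.2.2 = q.1.2.2 then
      G.γ (p.1.1, p.1.2.1, p.2) * star (G.γ (q.1.1, q.1.2.1, q.2))
    else 0

/-- The winning probability of a single player with access to both `A` and `B` who applies the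
quantum operation `W` on `ABE`. -/
def singleWinProb (G : RankOneGame a b c) {e : Type*} [Fintype e] [DecidableEq e]
    (η : EuclideanSpace ℂ e)
    (W : Matrix (a × b × e) (a × b × e) ℂ →ₗ[ℂ] Matrix (a × b × e) (a × b × e) ℂ) : ℝ :=
  (G.singleProjection e *
    tensorMap W LinearMap.id
      (Matrix.vecMulVec (G.singleInput η) (star (G.singleInput η)))).trace.re

/-- The winning probabilities of all strategies of a single player with access to both `A`
and `B`. -/
def singleWinProbs (G : RankOneGame a b c) : Set ℝ :=
  {p | ∃ (m : ℕ) (η : EuclideanSpace ℂ (Fin m))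
    (W : Matrix (a × b × Fin m) (a × b × Fin m) ℂ →ₗ[ℂ] Matrix (a × b × Fin m) (a × b × Fin m) ℂ),
    ‖η‖ = 1 ∧ IsQuantumOperation W ∧ p = G.singleWinProb η W}

end RankOneGame

/-! ## The games `A_n` -/

/-- The tensor power of a vector of `ℂ^a ⊗ ℂ^b ⊗ ℂ^c`, regrouped as a vector of
`(ℂ^a)^{⊗ n} ⊗ (ℂ^b)^{⊗ n} ⊗ (ℂ^c)^{⊗ n}`. -/
def tensorPowKet {a b c : Type*} (v : EuclideanSpace ℂ (a × b × c)) (n : ℕ) :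
    EuclideanSpace ℂ ((Fin n → a) × (Fin n → b) × (Fin n → c)) :=
  WithLp.toLp 2 fun p => ∏ k, v (p.1 k, p.2.1 k, p.2.2 k)

theorem norm_tensorPowKet {a b c : Type*} [Fintype a] [Fintype b] [Fintype c]
    (v : EuclideanSpace ℂ (a × b × c)) (n : ℕ) : ‖tensorPowKet v n‖ = ‖v‖ ^ n := by
  classical
  have h : ‖tensorPowKet v n‖ ^ 2 = (‖v‖ ^ n) ^ 2 := by
    rw [← pow_mul, mul_comm n 2, pow_mul, EuclideanSpace.norm_sq_eq, EuclideanSpace.norm_sq_eq]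
    have h1 : ∀ f : a × b × c → ℝ, (∑ i, f i) ^ n = ∑ p : Fin n → a × b × c, ∏ k, f (p k) := by
      intro f
      rw [← Fin.prod_const, Finset.prod_univ_sum, Fintype.piFinset_univ]
    rw [h1]
    refine Fintype.sum_equiv
      (((Equiv.refl _).prodCongr (Equiv.arrowProdEquivProdArrow (Fin n) (fun _ => b)
        (fun _ => c)).symm).trans
        (Equiv.arrowProdEquivProdArrow (Fin n) (fun _ => a) (fun _ => b × c)).symm) _ _ ?_
    intro p
    simp [tensorPowKet, norm_prod, Finset.prod_pow]
  exact (pow_left_inj₀ (norm_nonneg _) (by positivity) two_ne_zero).1 h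

/-- The basis vector `|i⟩_A |j⟩_B |k⟩_C` of three qubits. -/
noncomputable def ket (i j k : Fin 2) : EuclideanSpace ℂ (Fin 2 × Fin 2 × Fin 2) :=
  EuclideanSpace.single (i, j, k) 1

/-- The game `A_n`, with
`ψ_n = 2^{-n} ((|00⟩ + |11⟩)_{AB} |0⟩_C + (|00⟩ - |11⟩)_{AB} |1⟩_C)^{⊗ n}` and
`γ_n = 2^{-n/2} (|00⟩_{AB} |0⟩_C + |11⟩_{AB} |1⟩_C)^{⊗ n}`. -/
noncomputable def schurGame (n : ℕ) :
    RankOneGame (Fin n → Fin 2) (Fin n → Fin 2) (Fin n → Fin 2) where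
  ψ := (((2 : ℝ) ^ (-(n : ℝ)) : ℝ) : ℂ) •
    tensorPowKet ((ket 0 0 0 + ket 1 1 0) + (ket 0 0 1 - ket 1 1 1)) n
  γ := (((2 : ℝ) ^ (-(n : ℝ) / 2) : ℝ) : ℂ) • tensorPowKet (ket 0 0 0 + ket 1 1 1) n
  norm_ψ := by
    have h : ‖(ket 0 0 0 + ket 1 1 0) + (ket 0 0 1 - ket 1 1 1)‖ = 2 := by
      rw [EuclideanSpace.norm_eq, Real.sqrt_eq_iff_eq_sq (by positivity) (by norm_num)]
      simp [ket, Fintype.sum_prod_type, Fin.sum_univ_two]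
      norm_num
    rw [norm_smul, norm_tensorPowKet, h, Complex.norm_real,
      Real.norm_of_nonneg (by positivity), ← Real.rpow_natCast, ← Real.rpow_add (by norm_num)]
    simp
  norm_γ := by
    have h : ‖ket 0 0 0 + ket 1 1 1‖ = (2 : ℝ) ^ (1 / 2 : ℝ) := by
      rw [EuclideanSpace.norm_eq, ← Real.sqrt_eq_rpow]
      congr 1
      simp [ket, Fintype.sum_prod_type, Fin.sum_univ_two]
      norm_num
    rw [norm_smul, norm_tensorPowKet, h, Complex.norm_real,
      Real.norm_of_nonneg (by positivity), ← Real.rpow_natCast, ← Real.rpow_mul (by norm_num),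
      ← Real.rpow_add (by norm_num)]
    ring_nf
    simp

/-- The multiplier matrix `φ_n = 2^{-3n/2} A^{⊗ n}` with `A = [[1, 1], [1, -1]]`. -/
noncomputable def schurMatrix (n : ℕ) : Matrix (Fin n → Fin 2) (Fin n → Fin 2) ℂ :=
  (((2 : ℝ) ^ (-(3 * (n : ℝ) / 2)) : ℝ) : ℂ) • Matrix.tensorPow !![1, 1; 1, -1] n

/-! In Kraus form, a winning probability is a sum of squared amplitudes in which the referee enters
only through `M_AB`. In a Schur game with multiplier `φ` on `ℂ^N`, `M_AB` is `φ` placed on the span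
of the vectors `|xx⟩`, and zero elsewhere.

The entangled bound is `(B N)²`, where `B` bounds the entries of `φ`. Cauchy–Schwarz over the
returned label `x` costs `N`. Alice's and Bob's Kraus operators are isometries and cost nothing; the
entries of `φ` cost `B²`. Summing over the question label costs another `N`
(`IsSchurGameWith.entangledWinProb_le`).

For `A_n` all entries of `φ_n` have modulus `2^{-3n/2}` and `N = 2^n`, so the bound is `2^{-n}`. But
`φ_n` is `2^{-n}` times a unitary, so its `2^n` singular values sum to `1`. A single player reaches
`1` by undoing the Hadamard matrix that relates `ψ_n` to `γ_n`. -/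

/-! ### Kraus decompositions. -/

/-- The completely positive map `X ↦ ∑ᵣ Kᵣ X Kᵣᴴ` with Kraus operators `K`. -/
def krausMap {ι ρ : Type*} [Fintype ι] [Fintype ρ] (K : ρ → Matrix ι ι ℂ) :
    Matrix ι ι ℂ →ₗ[ℂ] Matrix ι ι ℂ where
  toFun X := ∑ r, K r * X * (K r)ᴴ
  map_add' X Y := by simp [Matrix.mul_add, Matrix.add_mul, Finset.sum_add_distrib]
  map_smul' c X := by simp [Finset.smul_sum]

theorem krausMap_apply {ι ρ : Type*} [Fintype ι] [Fintype ρ] (K : ρ → Matrix ι ι ℂ)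
    (X : Matrix ι ι ℂ) : krausMap K X = ∑ r, K r * X * (K r)ᴴ := rfl

theorem krausMap_one {ι : Type*} [Fintype ι] [DecidableEq ι] :
    krausMap (fun _ : Unit => (1 : Matrix ι ι ℂ)) = LinearMap.id := by
  ext1 X
  simp [krausMap_apply]

theorem krausMap_vecMulVec {ι ρ : Type*} [Fintype ι] [Fintype ρ] (K : ρ → Matrix ι ι ℂ)
    (v : ι → ℂ) : krausMap K (Matrix.vecMulVec v (star v)) =
      ∑ r, Matrix.vecMulVec (K r *ᵥ v) (star (K r *ᵥ v)) := by
  simp [krausMap_apply, Matrix.mul_vecMulVec, Matrix.vecMulVec_mul, Matrix.star_mulVec]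

theorem krausMap_posSemidef {ι ρ : Type*} [Fintype ι] [Fintype ρ] (K : ρ → Matrix ι ι ℂ)
    {X : Matrix ι ι ℂ} (hX : X.PosSemidef) : (krausMap K X).PosSemidef := by
  rw [krausMap_apply]
  exact Matrix.posSemidef_sum _ fun r _ => hX.mul_mul_conjTranspose_same (K r)

theorem trace_krausMap {ι ρ : Type*} [Fintype ι] [Fintype ρ] (K : ρ → Matrix ι ι ℂ)
    (X : Matrix ι ι ℂ) : (krausMap K X).trace = ((∑ r, (K r)ᴴ * K r) * X).trace := by
  rw [krausMap_apply, Matrix.trace_sum, Finset.sum_mul, Matrix.trace_sum]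
  refine Finset.sum_congr rfl fun r _ => ?_
  rw [Matrix.trace_mul_comm, Matrix.mul_assoc]

/-- Both sides are linear, and the matrix units of a product are Kronecker products of matrix units,
where `tensorMap_kronecker` applies. -/
theorem tensorMap_krausMap {ι κ ρ τ : Type*} [Fintype ι] [Fintype κ] [Fintype ρ] [Fintype τ]
    [DecidableEq ι] [DecidableEq κ] (K : ρ → Matrix ι ι ℂ) (L : τ → Matrix κ κ ℂ) :
    tensorMap (krausMap K) (krausMap L) = krausMap fun s : ρ × τ => K s.1 ⊗ₖ L s.2 := by
  have h (i j : ι) (k l : κ) : tensorMap (krausMap K) (krausMap L) (Matrix.single (i, k) (j, l) 1) =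
      krausMap (fun s : ρ × τ => K s.1 ⊗ₖ L s.2) (Matrix.single (i, k) (j, l) 1) := by
    have e : Matrix.single (i, k) (j, l) (1 : ℂ) =
        Matrix.single i j 1 ⊗ₖ Matrix.single k l 1 := by
      simp [Matrix.single_kronecker_single]
    rw [e, tensorMap_kronecker]
    simp only [krausMap_apply, Matrix.conjTranspose_kronecker, ← Matrix.mul_kronecker_mul,
      Fintype.sum_prod_type]
    ext p q
    simp [Matrix.sum_apply, Finset.sum_mul_sum]
  refine Matrix.ext_linearMap ℂ fun i j => LinearMap.ext fun c => ?_
  have := congrArg (c • ·) (h i.1 j.1 i.2 j.2)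
  simpa [← map_smul, Matrix.smul_single] using this

theorem isCompletelyPositive_krausMap {ι ρ : Type*} [Fintype ι] [DecidableEq ι] [Fintype ρ]
    (K : ρ → Matrix ι ι ℂ) : IsCompletelyPositive (krausMap K) := by
  intro k X hX
  rw [← krausMap_one, tensorMap_krausMap]
  exact krausMap_posSemidef _ hX

theorem isQuantumOperation_krausMap {ι ρ : Type*} [Fintype ι] [DecidableEq ι] [Fintype ρ]
    {K : ρ → Matrix ι ι ℂ} (hK : ∑ r, (K r)ᴴ * K r = 1) : IsQuantumOperation (krausMap K) where
  completelyPositive := isCompletelyPositive_krausMap K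
  trace_preserving X := by rw [trace_krausMap, hK, one_mul]

/-- Choi's theorem: a completely positive map has a Kraus decomposition. -/
theorem IsCompletelyPositive.exists_krausMap {ι : Type*} [Fintype ι] [DecidableEq ι]
    {T : Matrix ι ι ℂ →ₗ[ℂ] Matrix ι ι ℂ} (hT : IsCompletelyPositive T) :
    ∃ (m : ℕ) (K : Fin m → Matrix ι ι ℂ), T = krausMap K := by
  let f := Fintype.equivFin ι
  -- The unnormalized maximally entangled vector; `f` relabels `ι`, as complete positivity is tested
  -- on `Fin k`. The `(f i, f j)` block of the Choi matrix is `T` of a matrix unit, and its rank-one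
  -- summands `v r`, reshaped, are the Kraus operators.
  let ω : Fin (Fintype.card ι) × ι → ℂ := fun p => if p.1 = f p.2 then 1 else 0
  obtain ⟨m, v, hv⟩ := Matrix.posSemidef_iff_eq_sum_vecMulVec.1
    (hT _ _ (Matrix.posSemidef_vecMulVec_self_star ω))
  have key (i j p q : ι) : T (Matrix.single i j 1) p q =
      ∑ r, v r (f i, p) * star (v r (f j, q)) := by
    have h := congrFun (congrFun hv (f i, p)) (f j, q)
    have e : (Matrix.vecMulVec ω (star ω)).submatrix (Prod.mk (f i)) (Prod.mk (f j)) =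
        Matrix.single i j 1 := by
      ext k l
      simp only [ω, Matrix.submatrix_apply, Matrix.vecMulVec_apply, Matrix.single_apply,
        Pi.star_apply, f.injective.eq_iff]
      by_cases h1 : i = k <;> by_cases h2 : j = l <;> simp [h1, h2]
    simpa [tensorMap, e, Matrix.sum_apply, Matrix.vecMulVec_apply] using h
  refine ⟨m, fun r => Matrix.of fun p i => v r (f i, p), ?_⟩
  refine Matrix.ext_linearMap ℂ fun i j => LinearMap.ext fun c => ?_
  have h : T (Matrix.single i j 1) =
      krausMap (fun r => Matrix.of fun p i => v r (f i, p)) (Matrix.single i j 1) := by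
    ext p q
    rw [key, krausMap_apply, Matrix.sum_apply]
    refine Finset.sum_congr rfl fun r _ => ?_
    simp [Matrix.mul_apply, Matrix.single_apply, ite_and, Finset.sum_ite_eq]
  have := congrArg (c • ·) h
  simpa [← map_smul, Matrix.smul_single] using this

/-- Trace preservation determines `∑ Kᴴ K` because the trace pairing is nondegenerate. -/
theorem IsQuantumOperation.exists_krausMap {ι : Type*} [Fintype ι] [DecidableEq ι]
    {T : Matrix ι ι ℂ →ₗ[ℂ] Matrix ι ι ℂ} (hT : IsQuantumOperation T) :
    ∃ (m : ℕ) (K : Fin m → Matrix ι ι ℂ), T = krausMap K ∧ ∑ r, (K r)ᴴ * K r = 1 := by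
  obtain ⟨m, K, rfl⟩ := hT.completelyPositive.exists_krausMap
  refine ⟨m, K, rfl, Matrix.ext_iff_trace_mul_right.2 fun X => ?_⟩
  rw [← trace_krausMap, hT.trace_preserving, one_mul]

/-- Kraus operators of a trace-preserving map form an isometry. -/
theorem sum_norm_sq_mulVec {ι ρ : Type*} [Fintype ι] [DecidableEq ι] [Fintype ρ]
    {K : ρ → Matrix ι ι ℂ} (hK : ∑ r, (K r)ᴴ * K r = 1) (v : ι → ℂ) :
    ∑ r, ∑ p, ‖(K r *ᵥ v) p‖ ^ 2 = ∑ i, ‖v i‖ ^ 2 := by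
  have h (w : ι → ℂ) : ((∑ i, ‖w i‖ ^ 2 : ℝ) : ℂ) = star w ⬝ᵥ w := by
    simp [dotProduct, Complex.conj_mul']
  apply Complex.ofReal_injective
  rw [Complex.ofReal_sum]
  simp only [h, Matrix.star_mulVec]
  calc ∑ r, (star v ᵥ* (K r)ᴴ) ⬝ᵥ K r *ᵥ v = ∑ r, star v ⬝ᵥ ((K r)ᴴ * K r) *ᵥ v := by
        simp [Matrix.dotProduct_mulVec, Matrix.vecMul_vecMul]
    _ = star v ⬝ᵥ v := by
        rw [← dotProduct_sum, ← Matrix.sum_mulVec, hK, Matrix.one_mulVec]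

/-! ### Winning probabilities as sums of squared amplitudes. -/

/-- The probability of the outcome `|g⟩⟨g| ⊗ 1` in a pure state is a sum of squared amplitudes. -/
theorem trace_mul_vecMulVec_eq_sum_norm_sq {α κ : Type*} [Fintype α] [Fintype κ] [DecidableEq κ]
    (e : α → κ) (g w : α → ℂ) :
    ((Matrix.of fun p q => if e p = e q then g p * star (g q) else 0) *
      Matrix.vecMulVec w (star w)).trace =
      ((∑ k, ‖∑ p, if e p = k then star (g p) * w p else 0‖ ^ 2 : ℝ) : ℂ) := by
  -- The operator is block diagonal over the values `k` of `e`, the register on which the projection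
  -- acts as the identity.
  have h (k : κ) : ((‖∑ p, if e p = k then star (g p) * w p else 0‖ ^ 2 : ℝ) : ℂ) =
      ∑ p, ∑ q, if e p = k then
        (if e p = e q then g p * star (g q) else 0) * (w q * star (w p)) else 0 := by
    rw [Complex.ofReal_pow, ← Complex.conj_mul', map_sum, Finset.sum_mul_sum]
    refine Finset.sum_congr rfl fun p _ => Finset.sum_congr rfl fun q _ => ?_
    by_cases hp : e p = k
    · subst hp
      by_cases hq : e p = e q
      · simp [hq]; ring
      · simp [hq, Ne.symm hq]
    · simp [hp]
  rw [Complex.ofReal_sum]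
  simp only [h]
  rw [Finset.sum_comm]
  simp [Matrix.trace, Matrix.mul_apply, Matrix.vecMulVec_apply]

theorem tensorMap_krausMap_id {ι κ ρ : Type*} [Fintype ι] [Fintype κ] [Fintype ρ]
    [DecidableEq ι] [DecidableEq κ] (K : ρ → Matrix ι ι ℂ) :
    tensorMap (krausMap K) (LinearMap.id : Matrix κ κ ℂ →ₗ[ℂ] Matrix κ κ ℂ) =
      krausMap fun r => K r ⊗ₖ (1 : Matrix κ κ ℂ) := by
  rw [← krausMap_one, tensorMap_krausMap]
  ext1 X
  simp [krausMap_apply, Fintype.sum_prod_type]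

/-- A sum of `card s` vectors has squared norm at most `card s` times the sum of the squared
norms. -/
theorem norm_sum_sq_le_card_mul {ι : Type*} [Fintype ι] (f : ι → ℂ) :
    ‖∑ i, f i‖ ^ 2 ≤ Fintype.card ι * ∑ i, ‖f i‖ ^ 2 :=
  calc ‖∑ i, f i‖ ^ 2 ≤ (∑ i, ‖f i‖) ^ 2 := by gcongr; exact norm_sum_le _ _
    _ ≤ _ := by simpa using sq_sum_le_card_mul_sum_sq (s := Finset.univ) (f := fun i => ‖f i‖)

theorem norm_sum_mul_sq_le {ι : Type*} [Fintype ι] (f g : ι → ℂ) :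
    ‖∑ i, f i * g i‖ ^ 2 ≤ (∑ i, ‖f i‖ ^ 2) * ∑ i, ‖g i‖ ^ 2 :=
  calc ‖∑ i, f i * g i‖ ^ 2 ≤ (∑ i, ‖f i‖ * ‖g i‖) ^ 2 := by
        gcongr
        simpa using norm_sum_le Finset.univ fun i => f i * g i
    _ ≤ _ := Finset.sum_mul_sq_le_sq_mul_sq _ _ _

namespace RankOneGame

theorem sum_norm_sq_ψ {a b c : Type*} [Fintype a] [Fintype b] [Fintype c]
    (G : RankOneGame a b c) : ∑ p, ‖G.ψ p‖ ^ 2 = 1 := by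
  rw [← EuclideanSpace.norm_sq_eq, G.norm_ψ, one_pow]

theorem sum_norm_sq_γ {a b c : Type*} [Fintype a] [Fintype b] [Fintype c]
    (G : RankOneGame a b c) : ∑ p, ‖G.γ p‖ ^ 2 = 1 := by
  rw [← EuclideanSpace.norm_sq_eq, G.norm_γ, one_pow]

theorem sum_norm_sq_singleInput {a b c : Type*} [Fintype a] [Fintype b] [Fintype c]
    (G : RankOneGame a b c) {e : Type*} [Fintype e] (η : EuclideanSpace ℂ e) (hη : ‖η‖ = 1) :
    ∑ p, ‖G.singleInput η p‖ ^ 2 = 1 := by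
  have h : ∑ k, ‖η k‖ ^ 2 = 1 := by rw [← EuclideanSpace.norm_sq_eq, hη, one_pow]
  have h2 := G.sum_norm_sq_ψ
  simp only [Fintype.sum_prod_type] at h2 ⊢
  rw [← h2]
  refine Finset.sum_congr rfl fun x _ => Finset.sum_congr rfl fun y _ => ?_
  rw [Finset.sum_comm]
  refine Finset.sum_congr rfl fun z _ => ?_
  simp [singleInput, mul_pow, ← Finset.mul_sum, h]

/-- The amplitude of a pair of Kraus operators of the two players. -/
theorem amplitude_eq {a b c : Type*} [Fintype a] [Fintype b] [Fintype c]
    [DecidableEq c] (G : RankOneGame a b c) {a' b' : Type*} [Fintype a'] [Fintype b']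
    (ξ : EuclideanSpace ℂ (a' × b')) (K : Matrix (a × a') (a × a') ℂ)
    (L : Matrix (b × b') (b × b') ℂ) (i : a') (j : b') :
    ∑ x, ∑ y, ∑ z, star (G.γ (x, y, z)) *
      ((K ⊗ₖ (L ⊗ₖ (1 : Matrix c c ℂ))) *ᵥ G.sharedInput ξ) ((x, i), (y, j), z) =
    ∑ x, ∑ y, ∑ p, ∑ q, K (x, i) p * (L (y, j) q * (G.reduced (p.1, q.1) (x, y) *
      ξ (p.2, q.2))) := by
  refine Finset.sum_congr rfl fun x _ => Finset.sum_congr rfl fun y _ => ?_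
  have h (z : c) : star (G.γ (x, y, z)) *
      ((K ⊗ₖ (L ⊗ₖ (1 : Matrix c c ℂ))) *ᵥ G.sharedInput ξ) ((x, i), (y, j), z) =
      ∑ p, ∑ q, K (x, i) p * (L (y, j) q *
        ((G.ψ (p.1, q.1, z) * star (G.γ (x, y, z))) * ξ (p.2, q.2))) := by
    rw [Matrix.mulVec, dotProduct, Fintype.sum_prod_type, Finset.mul_sum]
    refine Finset.sum_congr rfl fun p _ => ?_
    rw [Fintype.sum_prod_type, Finset.mul_sum]
    refine Finset.sum_congr rfl fun q _ => ?_
    simp [Matrix.one_apply, sharedInput]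
    ring
  simp only [h]
  rw [Finset.sum_comm]
  refine Finset.sum_congr rfl fun p _ => ?_
  rw [Finset.sum_comm]
  refine Finset.sum_congr rfl fun q _ => ?_
  simp only [reduced, Matrix.of_apply, Finset.mul_sum, Finset.sum_mul]

/-- Evaluation at a matrix unit leaves one term of the sum, so the associated map determines every
entry of `M_AB`. -/
theorem IsSchurGameWith.reduced_apply {a c : Type*} [Fintype a] [Fintype c] [DecidableEq a]
    {G : RankOneGame a a c} {φ : Matrix a a ℂ}
    (hG : G.IsSchurGameWith φ) (r s u v : a) :
    G.reduced (r, s) (u, v) = if s = r ∧ v = u then φ r u else 0 := by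
  have h := congrFun (congrFun (hG (Matrix.single r u 1)) s) v
  simp only [reducedMap, Matrix.of_apply, Matrix.single_apply, Matrix.hadamard_apply, mul_ite,
    mul_one, mul_zero, ite_and, Finset.sum_ite_eq, Finset.mem_univ, if_true,
    Finset.sum_ite_irrel, Finset.sum_const_zero] at h
  rw [h]
  by_cases h1 : s = r <;> by_cases h2 : v = u <;> simp [h1, h2, Ne.symm]

variable {a b c : Type*} [Fintype a] [Fintype b] [Fintype c]
  [DecidableEq a] [DecidableEq b] [DecidableEq c]

/-- The single-player winning probability as a sum of squared amplitudes. -/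
theorem singleWinProb_krausMap (G : RankOneGame a b c) {e ρ : Type*} [Fintype e] [DecidableEq e]
    [Fintype ρ] (η : EuclideanSpace ℂ e) (K : ρ → Matrix (a × b × e) (a × b × e) ℂ) :
    G.singleWinProb η (krausMap K) = ∑ r, ∑ k, ‖∑ x, ∑ y, ∑ z,
      star (G.γ (x, y, z)) *
        ((K r ⊗ₖ (1 : Matrix c c ℂ)) *ᵥ G.singleInput η) ((x, y, k), z)‖ ^ 2 := by
  rw [singleWinProb, tensorMap_krausMap_id, krausMap_vecMulVec, Finset.mul_sum, Matrix.trace_sum,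
    Complex.re_sum]
  refine Finset.sum_congr rfl fun r _ => ?_
  rw [singleProjection, trace_mul_vecMulVec_eq_sum_norm_sq (fun p : (a × b × e) × c => p.1.2.2)
    (fun p => G.γ (p.1.1, p.1.2.1, p.2)), Complex.ofReal_re]
  refine Finset.sum_congr rfl fun k _ => ?_
  simp only [Fintype.sum_prod_type]
  congr 2
  refine Finset.sum_congr rfl fun x _ => Finset.sum_congr rfl fun y _ => ?_
  rw [Finset.sum_comm]
  simp

/-- Cauchy–Schwarz against the unit vector `γ` bounds each amplitude by a slice of the output
vector; the slices add up to a norm that the isometry preserves. -/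
theorem singleWinProb_le_one (G : RankOneGame a b c) {e : Type*} [Fintype e] [DecidableEq e]
    {η : EuclideanSpace ℂ e} (hη : ‖η‖ = 1)
    {W : Matrix (a × b × e) (a × b × e) ℂ →ₗ[ℂ] Matrix (a × b × e) (a × b × e) ℂ}
    (hW : IsQuantumOperation W) : G.singleWinProb η W ≤ 1 := by
  obtain ⟨m, K, rfl, hK⟩ := hW.exists_krausMap
  have hK' : ∑ r, (K r ⊗ₖ (1 : Matrix c c ℂ))ᴴ * (K r ⊗ₖ (1 : Matrix c c ℂ)) = 1 := by
    simp only [Matrix.conjTranspose_kronecker, ← Matrix.mul_kronecker_mul]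
    rw [← Matrix.one_kronecker_one, ← hK]
    ext p q
    simp [Matrix.sum_apply, Finset.sum_mul]
  rw [singleWinProb_krausMap, ← G.sum_norm_sq_singleInput η hη, ← sum_norm_sq_mulVec hK']
  refine Finset.sum_le_sum fun r _ => ?_
  set w := (K r ⊗ₖ (1 : Matrix c c ℂ)) *ᵥ G.singleInput η
  calc _ ≤ ∑ k, ∑ x, ∑ y, ∑ z, ‖w ((x, y, k), z)‖ ^ 2 := by
        refine Finset.sum_le_sum fun k _ => ?_
        have := norm_sum_mul_sq_le (fun p : a × b × c => star (G.γ p))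
          (fun p => w ((p.1, p.2.1, k), p.2.2))
        simp only [norm_star, G.sum_norm_sq_γ, one_mul] at this
        simpa only [Fintype.sum_prod_type] using this
    _ = _ := by
        simp only [Fintype.sum_prod_type]
        rw [Finset.sum_comm]
        refine Finset.sum_congr rfl fun x _ => ?_
        rw [Finset.sum_comm]

/-- The entangled winning probability as a sum of squared amplitudes. -/
theorem entangledWinProb_krausMap (G : RankOneGame a b c) {a' b' ρ τ : Type*} [Fintype a']
    [Fintype b'] [DecidableEq a'] [DecidableEq b'] [Fintype ρ] [Fintype τ]
    (ξ : EuclideanSpace ℂ (a' × b')) (K : ρ → Matrix (a × a') (a × a') ℂ)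
    (L : τ → Matrix (b × b') (b × b') ℂ) :
    G.entangledWinProb ξ (krausMap K) (krausMap L) = ∑ r, ∑ t, ∑ i, ∑ j,
      ‖∑ x, ∑ y, ∑ p, ∑ q, K r (x, i) p * (L t (y, j) q * (G.reduced (p.1, q.1) (x, y) *
        ξ (p.2, q.2)))‖ ^ 2 := by
  have hP : G.sharedProjection a' b' = Matrix.of fun p q =>
      if (p.1.2, p.2.1.2) = (q.1.2, q.2.1.2) then
        G.γ (p.1.1, p.2.1.1, p.2.2) * star (G.γ (q.1.1, q.2.1.1, q.2.2)) else 0 := by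
    ext p q
    simp [sharedProjection]
  rw [entangledWinProb, tensorMap_krausMap_id, tensorMap_krausMap, krausMap_vecMulVec,
    Finset.mul_sum, Matrix.trace_sum, Complex.re_sum, Fintype.sum_prod_type]
  refine Finset.sum_congr rfl fun r _ => Finset.sum_congr rfl fun t _ => ?_
  rw [hP, trace_mul_vecMulVec_eq_sum_norm_sq
    (fun p : (a × a') × (b × b') × c => (p.1.2, p.2.1.2))
    (fun p => G.γ (p.1.1, p.2.1.1, p.2.2)), Complex.ofReal_re, Fintype.sum_prod_type]
  refine Finset.sum_congr rfl fun i _ => Finset.sum_congr rfl fun j _ => ?_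
  rw [← amplitude_eq]
  congr 2
  simp only [Fintype.sum_prod_type, Prod.mk.injEq, ite_and]
  refine Finset.sum_congr rfl fun x _ => ?_
  rw [Finset.sum_comm]
  refine Finset.sum_congr rfl fun y _ => ?_
  rw [Finset.sum_comm, Finset.sum_comm (s := (Finset.univ : Finset b'))]
  rw [Finset.sum_comm]
  simp [Finset.sum_ite_irrel]

/-! ### The entangled bound for Schur games. -/

/-- The entangled winning probabilities of a Schur game on `ℂ^N` whose multiplier has entries
bounded by `B` are at most `(B N)²`. -/
theorem IsSchurGameWith.entangledWinProb_le {G : RankOneGame a a c} {φ : Matrix a a ℂ}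
    (hG : G.IsSchurGameWith φ) {B : ℝ} (hB : ∀ i j, ‖φ i j‖ ≤ B)
    {a' b' : Type*} [Fintype a'] [Fintype b'] [DecidableEq a'] [DecidableEq b']
    {ξ : EuclideanSpace ℂ (a' × b')} (hξ : ‖ξ‖ = 1)
    {T : Matrix (a × a') (a × a') ℂ →ₗ[ℂ] Matrix (a × a') (a × a') ℂ}
    {S : Matrix (a × b') (a × b') ℂ →ₗ[ℂ] Matrix (a × b') (a × b') ℂ}
    (hT : IsQuantumOperation T) (hS : IsQuantumOperation S) :
    G.entangledWinProb ξ T S ≤ (B * Fintype.card a) ^ 2 := by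
  obtain ⟨m, K, rfl, hK⟩ := hT.exists_krausMap
  obtain ⟨n, L, rfl, hL⟩ := hS.exists_krausMap
  rw [entangledWinProb_krausMap]
  -- The vector left for Alice once Bob has obtained outcome `t` and returned `(x, j)`; the Schur
  -- condition makes both questions equal `p.1` and both answers equal `x`.
  let h (t : Fin n) (j : b') (x : a) (p : a × a') : ℂ :=
    φ p.1 x * ∑ l, L t (x, j) (p.1, l) * ξ (p.2, l)
  have amp (r : Fin m) (t : Fin n) (i : a') (j : b') :
      ∑ x, ∑ y, ∑ p, ∑ q, K r (x, i) p * (L t (y, j) q * (G.reduced (p.1, q.1) (x, y) *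
        ξ (p.2, q.2))) = ∑ x, (K r *ᵥ h t j x) (x, i) := by
    refine Finset.sum_congr rfl fun x _ => ?_
    rw [Finset.sum_comm]
    refine Finset.sum_congr rfl fun p _ => ?_
    simp only [hG.reduced_apply, Fintype.sum_prod_type, h]
    simp only [ite_and, ite_mul, zero_mul, mul_ite, mul_zero, Finset.sum_ite_irrel,
      Finset.sum_const_zero, Finset.sum_ite_eq', Finset.mem_univ, if_true, Finset.mul_sum]
    exact Finset.sum_congr rfl fun l _ => by ring
  simp only [amp]
  -- Cauchy–Schwarz over `x` gives the first factor `N`. For fixed `x` only the output block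
  -- labelled `x` is read; passing to the whole output allows the isometry property.
  have alice (t : Fin n) (j : b') : ∑ r, ∑ i, ‖∑ x, (K r *ᵥ h t j x) (x, i)‖ ^ 2 ≤
      Fintype.card a * ∑ x, ∑ p, ‖h t j x p‖ ^ 2 := by
    calc _ ≤ ∑ r, ∑ i, Fintype.card a * ∑ x, ‖(K r *ᵥ h t j x) (x, i)‖ ^ 2 := by
          gcongr; exact norm_sum_sq_le_card_mul _
      _ = Fintype.card a * ∑ x, ∑ r, ∑ i, ‖(K r *ᵥ h t j x) (x, i)‖ ^ 2 := by
          simp only [← Finset.mul_sum]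
          congr 1
          symm
          rw [Finset.sum_comm]
          exact Finset.sum_congr rfl fun r _ => Finset.sum_comm
      _ ≤ Fintype.card a * ∑ x, ∑ r, ∑ p, ‖(K r *ᵥ h t j x) p‖ ^ 2 := by
          gcongr with x _ r _
          rw [Fintype.sum_prod_type]
          exact Finset.single_le_sum (f := fun y => ∑ i, ‖(K r *ᵥ h t j x) (y, i)‖ ^ 2)
            (fun _ _ => by positivity) (Finset.mem_univ x)
      _ = _ := by simp only [sum_norm_sq_mulVec hK]
  have hξ' : ∑ k, ∑ l, ‖ξ (k, l)‖ ^ 2 = 1 := by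
    rw [← Fintype.sum_prod_type' (f := fun k l => ‖ξ (k, l)‖ ^ 2), ← EuclideanSpace.norm_sq_eq, hξ,
      one_pow]
  have bob (p : a × a') : ∑ t, ∑ j, ∑ x, ‖h t j x p‖ ^ 2 ≤ B ^ 2 * ∑ l, ‖ξ (p.2, l)‖ ^ 2 := by
    -- This vector does not depend on `x`, so the sum over `x` is part of the norm of Bob's output
    -- and costs no factor.
    let v : a × b' → ℂ := fun q => if q.1 = p.1 then ξ (p.2, q.2) else 0
    have hv (t : Fin n) (x : a) (j : b') :
        (L t *ᵥ v) (x, j) = ∑ l, L t (x, j) (p.1, l) * ξ (p.2, l) := by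
      simp [Matrix.mulVec, dotProduct, Fintype.sum_prod_type, v, Finset.sum_ite_irrel]
    have hv' : ∑ q, ‖v q‖ ^ 2 = ∑ l, ‖ξ (p.2, l)‖ ^ 2 := by
      rw [Fintype.sum_prod_type, Finset.sum_eq_single p.1 (by intro y _ hy; simp [v, hy]) (by simp)]
      simp [v]
    calc _ ≤ ∑ t, ∑ j, ∑ x, B ^ 2 * ‖(L t *ᵥ v) (x, j)‖ ^ 2 := by
          gcongr with t _ j _ x _
          simp only [h, hv, norm_mul, mul_pow]
          gcongr
          exact hB _ _
      _ = B ^ 2 * ∑ t, ∑ q, ‖(L t *ᵥ v) q‖ ^ 2 := by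
          simp only [← Finset.mul_sum]
          congr 1
          refine Finset.sum_congr rfl fun t _ => ?_
          rw [Fintype.sum_prod_type, Finset.sum_comm]
      _ = _ := by rw [sum_norm_sq_mulVec hL, hv']
  calc _ = ∑ t, ∑ j, ∑ r, ∑ i, ‖∑ x, (K r *ᵥ h t j x) (x, i)‖ ^ 2 := by
        rw [Finset.sum_comm]
        refine Finset.sum_congr rfl fun t _ => ?_
        rw [Finset.sum_comm (s := (Finset.univ : Finset b'))]
        exact Finset.sum_congr rfl fun r _ => Finset.sum_comm
    _ ≤ ∑ t, ∑ j, Fintype.card a * ∑ x, ∑ p, ‖h t j x p‖ ^ 2 := by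
        gcongr with t _ j _
        exact alice t j
    _ = Fintype.card a * ∑ p, ∑ t, ∑ j, ∑ x, ‖h t j x p‖ ^ 2 := by
        simp only [← Finset.mul_sum]
        congr 1
        symm
        rw [Finset.sum_comm]
        refine Finset.sum_congr rfl fun t _ => ?_
        rw [Finset.sum_comm]
        exact Finset.sum_congr rfl fun j _ => Finset.sum_comm
    _ ≤ Fintype.card a * ∑ p : a × a', B ^ 2 * ∑ l, ‖ξ (p.2, l)‖ ^ 2 := by
        gcongr with p _
        exact bob p
    -- The sum over `p.1` gives the second factor `N`; the sum over `p.2` completes the norm of `ξ`.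
    _ = (B * Fintype.card a) ^ 2 := by
        rw [← Finset.mul_sum, Fintype.sum_prod_type]
        simp [hξ']
        ring

end RankOneGame

/-! ### The trace norm of a multiple of a partial isometry. -/

/-- An eigenvector of `Mᴴ M` with eigenvalue `σ²` gives `σ⁴ = r² σ²`, so every singular value is `0`
or `r` and `r σ = σ²`; the `σ²` sum to the trace. -/
theorem mul_traceNorm_eq_re_trace {ι : Type*} [Fintype ι] [DecidableEq ι] {M : Matrix ι ι ℂ}
    {r : ℝ} (hr : 0 ≤ r) (h : (Mᴴ * M) * (Mᴴ * M) = ((r ^ 2 : ℝ) : ℂ) • (Mᴴ * M)) :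
    r * traceNorm M = (Mᴴ * M).trace.re := by
  set T := Matrix.toEuclideanLin M with hT
  have hTM : LinearMap.adjoint T ∘ₗ T = Matrix.toEuclideanLin (Mᴴ * M) := by
    rw [hT, ← Matrix.toEuclideanLin_conjTranspose_eq_adjoint]
    ext v i
    simp [Matrix.toLpLin_apply]
  have hT2 : (LinearMap.adjoint T ∘ₗ T) ∘ₗ (LinearMap.adjoint T ∘ₗ T) =
      ((r ^ 2 : ℝ) : ℂ) • (LinearMap.adjoint T ∘ₗ T) := by
    have e : Matrix.toEuclideanLin (Mᴴ * M) ∘ₗ Matrix.toEuclideanLin (Mᴴ * M) =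
        Matrix.toEuclideanLin ((Mᴴ * M) * (Mᴴ * M)) := by
      ext v i
      simp [Matrix.toLpLin_apply]
    rw [hTM, e, h, map_smul]
  have hσ (i : ℕ) : r * T.singularValues i = T.singularValues i ^ 2 := by
    by_cases hi : i < Module.finrank ℂ (EuclideanSpace ℂ ι)
    · obtain ⟨v, hv⟩ := (T.hasEigenvalue_adjoint_comp_self_sq_singularValues hi).exists_hasEigenvector
      have h1 := hv.apply_eq_smul
      have h2 := LinearMap.congr_fun hT2 v
      rw [LinearMap.comp_apply, h1, map_smul, LinearMap.smul_apply, h1, smul_smul, smul_smul] at h2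
      have h3 := smul_left_injective ℂ hv.2 h2
      have h4 : T.singularValues i ^ 2 * T.singularValues i ^ 2 =
          r ^ 2 * T.singularValues i ^ 2 :=
            Complex.ofReal_injective (by
              rw [Complex.ofReal_mul, Complex.ofReal_mul, Complex.ofReal_pow]; exact h3)
      rcases eq_or_ne (T.singularValues i) 0 with h0 | h0
      · simp [h0]
      · have h5 := mul_right_cancel₀ (pow_ne_zero 2 h0) h4
        rw [(pow_left_inj₀ (T.singularValues_nonneg i) hr two_ne_zero).1 h5]
        ring
    -- Singular values are indexed by all of `ℕ` and vanish from the dimension on.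
    · simp [T.singularValues_of_finrank_le (not_lt.1 hi)]
  have htr : (Mᴴ * M).trace = LinearMap.trace ℂ _ (LinearMap.adjoint T ∘ₗ T) := by
    rw [hTM, LinearEquiv.congr_fun (Matrix.toLpLin_eq_toLin 2 2) (Mᴴ * M),
      LinearMap.trace_eq_matrix_trace ℂ (PiLp.basisFun 2 ℂ ι), LinearMap.toMatrix_toLin]
  rw [htr]
  refine Eq.trans ?_ (T.isSymmetric_adjoint_comp_self.re_trace_eq_sum_eigenvalues rfl).symm
  simp only [← T.sq_singularValues_fin rfl, ← hσ]
  rw [← Finset.mul_sum, traceNorm, Finsupp.sum_of_support_subset (s := Finset.range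
    (Module.finrank ℂ (EuclideanSpace ℂ ι))), Finset.sum_range]
  · intro i hi
    by_contra h'
    exact Finsupp.mem_support_iff.1 hi (T.singularValues_of_finrank_le (by simpa using h'))
  · simp

/-! ### Hadamard powers and the multiplier of `A_n`. -/

theorem Matrix.tensorPow_mul {ι : Type*} [Fintype ι] (A B : Matrix ι ι ℂ) (n : ℕ) :
    A.tensorPow n * B.tensorPow n = (A * B).tensorPow n := by
  ext x y
  simp only [Matrix.tensorPow, Matrix.mul_apply, Matrix.of_apply, ← Finset.prod_mul_distrib,
    Finset.prod_univ_sum, Fintype.piFinset_univ]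

theorem Matrix.tensorPow_smul_one {ι : Type*} [DecidableEq ι] (r : ℂ) (n : ℕ) :
    (r • (1 : Matrix ι ι ℂ)).tensorPow n = r ^ n • 1 := by
  ext x y
  simp [Matrix.tensorPow, Matrix.one_apply, Finset.prod_ite_zero, funext_iff]

/-- With `α = 2^{-n/2}` the constants of the game become `α²` and `α³`, and `α² 2^n = 1` is the only
relation needed between them. -/
theorem two_rpow_neg_half_sq_mul (n : ℕ) : ((2 : ℝ) ^ (-(n : ℝ) / 2)) ^ 2 * 2 ^ n = 1 := by
  rw [← Real.rpow_natCast 2 n, ← Real.rpow_natCast, ← Real.rpow_mul (by norm_num),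
    ← Real.rpow_add (by norm_num)]
  simp

theorem two_rpow_neg_eq (n : ℕ) : (2 : ℝ) ^ (-(n : ℝ)) = ((2 : ℝ) ^ (-(n : ℝ) / 2)) ^ 2 := by
  rw [← Real.rpow_natCast, ← Real.rpow_mul (by norm_num)]
  simp

theorem two_rpow_neg_three_halves_eq (n : ℕ) :
    (2 : ℝ) ^ (-(3 * (n : ℝ) / 2)) = ((2 : ℝ) ^ (-(n : ℝ) / 2)) ^ 3 := by
  rw [← Real.rpow_natCast, ← Real.rpow_mul (by norm_num)]
  push_cast
  ring_nf

/-- The matrix `A^{⊗ n}` with `A = [[1, 1], [1, -1]]`. -/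
def hadamardPow (n : ℕ) : Matrix (Fin n → Fin 2) (Fin n → Fin 2) ℂ :=
  Matrix.tensorPow !![1, 1; 1, -1] n

theorem hadamardPow_conjTranspose (n : ℕ) : (hadamardPow n)ᴴ = hadamardPow n := by
  ext x y
  simp only [hadamardPow, Matrix.tensorPow, Matrix.conjTranspose_apply, Matrix.of_apply, star_prod]
  refine Finset.prod_congr rfl fun k _ => ?_
  generalize x k = i
  generalize y k = j
  fin_cases i <;> fin_cases j <;> simp

theorem norm_hadamardPow_apply (n : ℕ) (x y : Fin n → Fin 2) : ‖hadamardPow n x y‖ = 1 := by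
  simp only [hadamardPow, Matrix.tensorPow, Matrix.of_apply, norm_prod]
  refine Finset.prod_eq_one fun k _ => ?_
  generalize x k = i
  generalize y k = j
  fin_cases i <;> fin_cases j <;> simp

theorem hadamardPow_mul_self (n : ℕ) : hadamardPow n * hadamardPow n = (2 ^ n : ℂ) • 1 := by
  have h : !![(1 : ℂ), 1; 1, -1] * !![1, 1; 1, -1] = (2 : ℂ) • 1 := by
    ext i j
    fin_cases i <;> fin_cases j <;> norm_num [Matrix.mul_apply, Fin.sum_univ_two]
  rw [hadamardPow, Matrix.tensorPow_mul, h, Matrix.tensorPow_smul_one]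

theorem schurGame_ψ_apply (n : ℕ) (x y z : Fin n → Fin 2) : (schurGame n).ψ (x, y, z) =
    (((2 : ℝ) ^ (-(n : ℝ)) : ℝ) : ℂ) * if y = x then hadamardPow n x z else 0 := by
  have h (i j k : Fin 2) : ((ket 0 0 0 + ket 1 1 0) + (ket 0 0 1 - ket 1 1 1)) (i, j, k) =
      if j = i then !![(1 : ℂ), 1; 1, -1] i k else 0 := by
    fin_cases i <;> fin_cases j <;> fin_cases k <;> simp [ket]
  simp only [schurGame, tensorPowKet, PiLp.smul_apply, smul_eq_mul, h, Finset.prod_ite_zero]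
  simp [funext_iff, hadamardPow, Matrix.tensorPow]

theorem schurGame_γ_apply (n : ℕ) (x y z : Fin n → Fin 2) : (schurGame n).γ (x, y, z) =
    (((2 : ℝ) ^ (-(n : ℝ) / 2) : ℝ) : ℂ) * if y = x ∧ z = x then 1 else 0 := by
  have h (i j k : Fin 2) : (ket 0 0 0 + ket 1 1 1) (i, j, k) =
      if j = i ∧ k = i then (1 : ℂ) else 0 := by
    fin_cases i <;> fin_cases j <;> fin_cases k <;> simp [ket]
  simp only [schurGame, tensorPowKet, PiLp.smul_apply, smul_eq_mul, h, Finset.prod_ite_zero]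
  simp [funext_iff, forall_and]

theorem schurMatrix_apply (n : ℕ) (x y : Fin n → Fin 2) : schurMatrix n x y =
    (((2 : ℝ) ^ (-(3 * (n : ℝ) / 2)) : ℝ) : ℂ) * hadamardPow n x y := rfl

/-- In the sum over `C`, `γ` selects the single term `k = u`, with weight `α² · α = α³`. -/
theorem schurGame_reduced_apply (n : ℕ) (r s u v : Fin n → Fin 2) :
    (schurGame n).reduced (r, s) (u, v) = if s = r ∧ v = u then schurMatrix n r u else 0 := by
  simp only [RankOneGame.reduced, Matrix.of_apply, schurGame_ψ_apply, schurGame_γ_apply,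
    schurMatrix_apply, two_rpow_neg_eq, two_rpow_neg_three_halves_eq]
  generalize (2 : ℝ) ^ (-(n : ℝ) / 2) = α
  by_cases h1 : s = r <;> by_cases h2 : v = u <;> simp [h1, h2, apply_ite (starRingEnd ℂ)]
  ring

theorem isSchurGameWith_schurGame (n : ℕ) : (schurGame n).IsSchurGameWith (schurMatrix n) := by
  intro X
  ext s v
  simp [RankOneGame.reducedMap, schurGame_reduced_apply, ite_and, Finset.sum_ite_irrel]

theorem norm_schurMatrix_apply (n : ℕ) (x y : Fin n → Fin 2) :
    ‖schurMatrix n x y‖ = (2 : ℝ) ^ (-(3 * (n : ℝ) / 2)) := by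
  rw [schurMatrix_apply, norm_mul, norm_hadamardPow_apply, Complex.norm_real,
    Real.norm_of_nonneg (by positivity), mul_one]

theorem conjTranspose_mul_schurMatrix (n : ℕ) :
    (schurMatrix n)ᴴ * schurMatrix n = ((((2 : ℝ) ^ (-(n : ℝ))) ^ 2 : ℝ) : ℂ) • 1 := by
  have e : schurMatrix n = (((2 : ℝ) ^ (-(3 * (n : ℝ) / 2)) : ℝ) : ℂ) • hadamardPow n := rfl
  rw [e, Matrix.conjTranspose_smul, hadamardPow_conjTranspose, Matrix.smul_mul, Matrix.mul_smul,
    hadamardPow_mul_self, smul_smul, smul_smul, Complex.star_def, Complex.conj_ofReal,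
    two_rpow_neg_eq, two_rpow_neg_three_halves_eq]
  have h : (((2 : ℝ) ^ (-(n : ℝ) / 2) : ℝ) : ℂ) ^ 2 * 2 ^ n = 1 := by
    exact_mod_cast two_rpow_neg_half_sq_mul n
  congr 1
  push_cast
  linear_combination (((2 : ℝ) ^ (-(n : ℝ) / 2) : ℝ) : ℂ) ^ 4 * h

/-- The diagonal matrix is the projection onto the span of the `|uu⟩`, on which `M_AB` acts as
`φ_n`. -/
theorem schurGame_conjTranspose_mul_reduced (n : ℕ) :
    ((schurGame n).reduced)ᴴ * (schurGame n).reduced =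
      ((((2 : ℝ) ^ (-(n : ℝ))) ^ 2 : ℝ) : ℂ) •
        Matrix.diagonal fun p : (Fin n → Fin 2) × (Fin n → Fin 2) =>
          if p.2 = p.1 then (1 : ℂ) else 0 := by
  ext ⟨u, v⟩ ⟨u', v'⟩
  have h := congrFun (congrFun (conjTranspose_mul_schurMatrix n) u) u'
  simp only [Matrix.mul_apply, Matrix.conjTranspose_apply, Matrix.smul_apply,
    Matrix.one_apply] at h
  simp only [Matrix.mul_apply, Matrix.conjTranspose_apply, Fintype.sum_prod_type,
    schurGame_reduced_apply, Matrix.smul_apply, Matrix.diagonal_apply, Prod.mk.injEq]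
  generalize (((2 : ℝ) ^ (-(n : ℝ))) ^ 2 : ℝ) = r at h ⊢
  by_cases h1 : v = u <;> by_cases h2 : v' = u'
  · subst h1 h2
    simpa [Finset.sum_ite_irrel, ite_and] using h
  · subst h1
    simp only [h2, and_false, if_false, mul_zero, Finset.sum_const_zero]
    rw [if_neg (fun h' => h2 (h'.2.symm.trans h'.1)), smul_zero]
  · simp [h1]
  · simp [h1]

/-- With `r = 2^{-n}`, the trace is `2^n r² = r`, which forces trace norm `1`. -/
theorem maximalValue_schurGame (n : ℕ) : (schurGame n).maximalValue = 1 := by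
  have hpos : (0 : ℝ) < (2 : ℝ) ^ (-(n : ℝ)) := by positivity
  have h := mul_traceNorm_eq_re_trace (M := (schurGame n).reduced) hpos.le (by
    rw [schurGame_conjTranspose_mul_reduced, Matrix.smul_mul, Matrix.mul_smul,
      Matrix.diagonal_mul_diagonal]
    simp)
  have ht : (((schurGame n).reduced)ᴴ * (schurGame n).reduced).trace.re = (2 : ℝ) ^ (-(n : ℝ)) := by
    rw [schurGame_conjTranspose_mul_reduced, Matrix.trace_smul, Matrix.trace_diagonal,
      Fintype.sum_prod_type]
    simp only [Finset.sum_ite_eq', Finset.mem_univ, if_true, Finset.sum_const, Finset.card_univ,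
      Fintype.card_pi, Fintype.card_fin, Finset.prod_const, nsmul_eq_mul, mul_one, smul_eq_mul]
    rw [Complex.re_ofReal_mul, two_rpow_neg_eq]
    have h := two_rpow_neg_half_sq_mul n
    have e : (((2 ^ n : ℕ) : ℂ)).re = 2 ^ n := by rw [Complex.natCast_re]; simp
    rw [e]
    linear_combination ((2 : ℝ) ^ (-(n : ℝ) / 2)) ^ 2 * h
  rw [ht] at h
  rw [RankOneGame.maximalValue, mul_left_cancel₀ hpos.ne' (h.trans (mul_one _).symm), one_pow]

theorem entangledWinProb_schurGame_le (n : ℕ) {p : ℝ} (hp : p ∈ (schurGame n).entangledWinProbs) :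
    p ≤ (2 : ℝ) ^ (-(n : ℝ)) := by
  obtain ⟨k, l, ξ, T, S, hξ, hT, hS, rfl⟩ := hp
  refine ((isSchurGameWith_schurGame n).entangledWinProb_le
    (fun i j => (norm_schurMatrix_apply n i j).le) hξ hT hS).trans_eq ?_
  simp only [Fintype.card_pi, Fintype.card_fin, Finset.prod_const, Finset.card_univ]
  rw [two_rpow_neg_eq, two_rpow_neg_three_halves_eq]
  have h := two_rpow_neg_half_sq_mul n
  push_cast
  generalize (2 : ℝ) ^ (-(n : ℝ) / 2) = α at h ⊢
  -- From `(α³ 2^n)² - α² = α² ((α² 2^n)² - 1)`, factored as a difference of squares.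
  linear_combination α ^ 2 * (α ^ 2 * 2 ^ n + 1) * h

theorem entangledWinProbs_nonempty {a b c : Type*} [Fintype a] [Fintype b] [Fintype c]
    [DecidableEq a] [DecidableEq b] [DecidableEq c] (G : RankOneGame a b c) :
    G.entangledWinProbs.Nonempty := by
  exact ⟨_, 1, 1, EuclideanSpace.single (0, 0) 1, _, _, by simp,
    isQuantumOperation_krausMap (K := fun _ : Unit => 1) (by simp),
    isQuantumOperation_krausMap (K := fun _ : Unit => 1) (by simp), rfl⟩

/-! ### The perfect single-player strategy. -/

/-- The unitary `|x, y⟩ ↦ 2^{-n/2} ∑ₚ (A^{⊗ n})_{px} |p, x + y - p⟩` of a single player. -/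
noncomputable def singlePlayerUnitary (n : ℕ) :
    Matrix ((Fin n → Fin 2) × (Fin n → Fin 2) × Fin 1)
      ((Fin n → Fin 2) × (Fin n → Fin 2) × Fin 1) ℂ :=
  Matrix.of fun p q => if p.2.1 = q.1 + q.2.1 - p.1 then
    (((2 : ℝ) ^ (-(n : ℝ) / 2) : ℝ) : ℂ) * hadamardPow n p.1 q.1 else 0

theorem two_rpow_neg_half_mul_self (n : ℕ) : (((2 : ℝ) ^ (-(n : ℝ) / 2) : ℝ) : ℂ) *
    (((2 : ℝ) ^ (-(n : ℝ) / 2) : ℝ) : ℂ) * 2 ^ n = 1 := by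
  rw [← pow_two]
  exact_mod_cast two_rpow_neg_half_sq_mul n

theorem sum_hadamardPow_mul (n : ℕ) (x y : Fin n → Fin 2) :
    ∑ p, hadamardPow n x p * hadamardPow n p y = if x = y then 2 ^ n else 0 := by
  have := congrFun (congrFun (hadamardPow_mul_self n) x) y
  simpa [Matrix.mul_apply, Matrix.one_apply] using this

/-- The unitary preserves `x + y`, so columns with different sums have disjoint supports; for equal
sums the overlap is that of two Hadamard columns. -/
theorem conjTranspose_mul_singlePlayerUnitary (n : ℕ) :
    (singlePlayerUnitary n)ᴴ * singlePlayerUnitary n = 1 := by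
  ext ⟨x, y, i⟩ ⟨x', y', j⟩
  obtain rfl := Subsingleton.elim i j
  have hs (p : Fin n → Fin 2) : star (hadamardPow n p x) = hadamardPow n x p :=
    congrFun (congrFun (hadamardPow_conjTranspose n) x) p
  simp only [singlePlayerUnitary, Matrix.mul_apply, Matrix.conjTranspose_apply, Matrix.of_apply,
    Fintype.sum_prod_type, Finset.univ_unique, Finset.sum_singleton, apply_ite star, star_zero,
    ite_mul, zero_mul, Finset.sum_ite_eq', Finset.mem_univ, if_true, star_mul', hs,
    Complex.star_def, Complex.conj_ofReal, Matrix.one_apply, Prod.mk.injEq, and_true,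
    sub_left_inj, mul_ite, mul_zero]
  by_cases h : x + y = x' + y'
  · simp only [h, if_true]
    have e : (x = x' ∧ y = y') ↔ x = x' :=
      ⟨And.left, fun hx => ⟨hx, by subst hx; exact add_left_cancel h⟩⟩
    simp only [e]
    calc _ = (((2 : ℝ) ^ (-(n : ℝ) / 2) : ℝ) : ℂ) * (((2 : ℝ) ^ (-(n : ℝ) / 2) : ℝ) : ℂ) *
          ∑ p, hadamardPow n x p * hadamardPow n p x' := by
          rw [Finset.mul_sum]
          exact Finset.sum_congr rfl fun p _ => by ring
      _ = _ := by
          rw [sum_hadamardPow_mul, mul_ite, mul_zero, two_rpow_neg_half_mul_self]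
  · have e : ¬ (x = x' ∧ y = y') := fun h' => h (by rw [h'.1, h'.2])
    simp [Ne.symm h, e]

/-- The Hadamard matrix in the unitary cancels the one in `ψ`. Only outputs `(x, x)` matter, since
`γ` vanishes elsewhere. -/
theorem singlePlayerUnitary_mulVec (n : ℕ) (η : EuclideanSpace ℂ (Fin 1))
    (x z : Fin n → Fin 2) (i : Fin 1) :
    ((singlePlayerUnitary n ⊗ₖ (1 : Matrix (Fin n → Fin 2) (Fin n → Fin 2) ℂ)) *ᵥ
      (schurGame n).singleInput η) ((x, x, i), z) =
      (schurGame n).γ (x, x, z) * η i := by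
  obtain rfl := Subsingleton.elim i 0
  -- Arithmetic mod 2: `p + p = 0` and `-x = x`, so `|pp⟩` is sent into the span of the `|xx⟩`.
  have h2 (p : Fin n → Fin 2) : x = p + p - x := by
    ext k
    simp only [Pi.add_apply, Pi.sub_apply]
    generalize x k = i
    generalize p k = j
    fin_cases i <;> fin_cases j <;> rfl
  have e : (((2 : ℝ) ^ (-(n : ℝ)) : ℝ) : ℂ) * 2 ^ n = 1 := by
    rw [two_rpow_neg_eq]
    exact_mod_cast two_rpow_neg_half_sq_mul n
  simp only [Matrix.mulVec, dotProduct, Fintype.sum_prod_type, Matrix.kroneckerMap_apply,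
    Matrix.one_apply, RankOneGame.singleInput, schurGame_ψ_apply, schurGame_γ_apply,
    Finset.univ_unique, Finset.sum_singleton, mul_ite, mul_one, mul_zero, ite_mul, zero_mul,
    Finset.sum_ite_irrel, Finset.sum_const_zero, Finset.sum_ite_eq, Finset.mem_univ, if_true, true_and,
    Finset.sum_ite_eq',
    singlePlayerUnitary, Matrix.of_apply, ← h2, Fin.default_eq_zero, Fin.isValue]
  calc _ = (((2 : ℝ) ^ (-(n : ℝ) / 2) : ℝ) : ℂ) * (((2 : ℝ) ^ (-(n : ℝ)) : ℝ) : ℂ) * η 0 *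
          ∑ p, hadamardPow n x p * hadamardPow n p z := by
          rw [Finset.mul_sum]
          exact Finset.sum_congr rfl fun p _ => by ring
    _ = _ := by
          rw [sum_hadamardPow_mul]
          by_cases h : z = x
          · simp only [h, if_true]
            linear_combination (((2 : ℝ) ^ (-(n : ℝ) / 2) : ℝ) : ℂ) * η 0 * e
          · simp [h, Ne.symm h]

theorem singleWinProb_singlePlayerUnitary (n : ℕ) :
    (schurGame n).singleWinProb (EuclideanSpace.single (0 : Fin 1) 1)
      (krausMap fun _ : Unit => singlePlayerUnitary n) = 1 := by
  have h (x y z : Fin n → Fin 2) : star ((schurGame n).γ (x, y, z)) *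
      ((singlePlayerUnitary n ⊗ₖ (1 : Matrix (Fin n → Fin 2) (Fin n → Fin 2) ℂ)) *ᵥ
        (schurGame n).singleInput (EuclideanSpace.single (0 : Fin 1) 1)) ((x, y, 0), z) =
      ((‖(schurGame n).γ (x, y, z)‖ ^ 2 : ℝ) : ℂ) := by
    by_cases hy : y = x
    · subst hy
      rw [singlePlayerUnitary_mulVec, Complex.ofReal_pow, ← Complex.conj_mul']
      simp
    · simp [schurGame_γ_apply, hy]
  have hγ := (schurGame n).sum_norm_sq_γ
  rw [RankOneGame.singleWinProb_krausMap]
  simp only [Finset.univ_unique, Finset.sum_singleton, Fin.default_eq_zero, h]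
  simp only [Fintype.sum_prod_type] at hγ
  simp only [← Complex.ofReal_sum, hγ]
  simp

/-! ### The main theorem. -/

/-- The `IsLUB` clause for the entangled value rules out the default value `0` that a real `sSup`
takes on empty or unbounded sets. The single-player supremum is attained. -/
theorem mainTheorem10 (n : ℕ) :
    (schurGame n).IsSchurGameWith (schurMatrix n) ∧
    (schurGame n).maximalValue = 1 ∧
    IsLUB (schurGame n).singleWinProbs 1 ∧
    IsLUB (schurGame n).entangledWinProbs (schurGame n).entangledValue ∧
    (schurGame n).entangledValue ≤ (2 : ℝ) ^ (-(n : ℝ)) := by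
  refine ⟨isSchurGameWith_schurGame n, maximalValue_schurGame n, ⟨?_, fun B hB => hB ?_⟩,
    isLUB_csSup (entangledWinProbs_nonempty _) ⟨_, fun p => entangledWinProb_schurGame_le n⟩,
    csSup_le (entangledWinProbs_nonempty _) fun p => entangledWinProb_schurGame_le n⟩
  · rintro p ⟨m, η, W, hη, hW, rfl⟩
    exact RankOneGame.singleWinProb_le_one _ hη hW
  · exact ⟨1, EuclideanSpace.single 0 1, _, by simp,
      isQuantumOperation_krausMap (by simpa using conjTranspose_mul_singlePlayerUnitary n),
      (singleWinProb_singlePlayerUnitary n).symm⟩
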